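/- Let $p$ be a prime, let $q$ be a power of $p$, and let $F=\mathbb{F}_q(t)$. Let $n,r\ge 0$ and let $$P=\sum_{i=0}^{n}\sum_{j=0}^{r} c_{i,j}\,x_i^{p^j}$$ be a separable $p$-polynomial, i.e. $c_{i,0}\neq 0$ for at least one $i$, with all coefficients $c_{i,j}\in\mathbb{F}_q[t]$. Let $G$ be the kernel of the homomorphism $P:\mathbb{G}_a^{n+1}\to\mathbb{G}_a$ of algebraic groups over $F$, and assume that $G$ is an $F$-form of $\mathbb{G}_a^n$, i.e. that $G$ becomes isomorphic to $\mathbb{G}_a^n$ over an algebraic closure of $F$. If $\deg(c_{i,j})<p^j$ for all $i,j$ (with $\deg 0=-\infty$), then the Tate-Shafarevich group $$\text{Ш}(G)=\ker\Bigl(H^1(F,G)\to\prod_v H^1(F_v,G)\Bigr)$$ is trivial. Here $v$ runs over all places of $F$ (including the place at infinity), $F_v$ is the completion of $F$ at $v$, and, for $K=F$ or $K=F_v$ with separable closure $K_s$, $H^1(K,G)=H^1(\mathrm{Gal}(K_s/K),G(K_s))$ is Galois cohomology with continuous cocycles. No smooth compactification of $G$ is assumed to exist. -/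

import Mathlib

open scoped Polynomial

universe u v w

noncomputable section

namespace WoundSha

/-! ### Groups cut out by a `p`-polynomial -/

section PPolynomial

variable {F : Type u} [Field F] (p : ℕ) {m r : ℕ} (c : Fin m → Fin (r + 1) → F)

/-- The `p`-polynomial `∑_{i,j} c_{i,j} x_i ^ (p ^ j)` in `m` variables. -/
def pPolynomial : MvPolynomial (Fin m) F :=
  ∑ i, ∑ j, MvPolynomial.C (c i j) * MvPolynomial.X i ^ p ^ (j : ℕ)

theorem aeval_pPolynomial {R : Type v} [CommRing R] [Algebra F R] (x : Fin m → R) :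
    MvPolynomial.aeval x (pPolynomial p c) =
      ∑ i, ∑ j, algebraMap F R (c i j) * x i ^ p ^ (j : ℕ) := by
  simp [pPolynomial]

theorem aeval_pPolynomial_add [Fact p.Prime] [CharP F p] {R : Type v} [CommRing R] [Algebra F R]
    (x y : Fin m → R) :
    MvPolynomial.aeval (x + y) (pPolynomial p c) =
      MvPolynomial.aeval x (pPolynomial p c) + MvPolynomial.aeval y (pPolynomial p c) := by
  rcases subsingleton_or_nontrivial R with h | h
  · exact Subsingleton.elim _ _
  · have : CharP R p := charP_of_injective_algebraMap (algebraMap F R).injective p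
    simp only [aeval_pPolynomial, Pi.add_apply, add_pow_char_pow, mul_add,
      Finset.sum_add_distrib]

variable [Fact p.Prime] [CharP F p]

/-- The homomorphism `R ^ m → R` given by the `p`-polynomial, on points in an `F`-algebra `R`. -/
def pHom (R : Type v) [CommRing R] [Algebra F R] : (Fin m → R) →+ R :=
  AddMonoidHom.mk' (fun x ↦ MvPolynomial.aeval x (pPolynomial p c)) (aeval_pPolynomial_add p c)

/-- The group `G(R) = {x ∈ R ^ m | P(x) = 0}` of `R`-points of the closed subgroup scheme `G` of
`𝔾ₐ ^ m` cut out by the `p`-polynomial `P`. -/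
def points (R : Type v) [CommRing R] [Algebra F R] : AddSubgroup (Fin m → R) :=
  (pHom p c R).ker

/-- The map `G(R) → G(S)` induced by a homomorphism of `F`-algebras `R → S`. -/
def pointsMap {R : Type v} {S : Type w} [CommRing R] [Algebra F R] [CommRing S] [Algebra F S]
    (f : R →ₐ[F] S) : points p c R →+ points p c S where
  toFun x := ⟨fun i ↦ f (x.1 i), by
    have hx : MvPolynomial.aeval x.1 (pPolynomial p c) = 0 := x.2
    change MvPolynomial.aeval (fun i ↦ f (x.1 i)) (pPolynomial p c) = 0
    rw [aeval_pPolynomial] at hx ⊢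
    simpa using congrArg f hx⟩
  map_zero' := by ext i; simp
  map_add' x y := by ext i; simp

@[simp]
theorem pointsMap_apply {R : Type v} {S : Type w} [CommRing R] [Algebra F R] [CommRing S]
    [Algebra F S] (f : R →ₐ[F] S) (x : points p c R) (i : Fin m) :
    (pointsMap p c f x).1 i = f (x.1 i) :=
  rfl

/-- `G` is a form of `𝔾ₐ ^ n`: over the algebraic closure of `F`, the group schemes `G` and
`𝔾ₐ ^ n` are isomorphic. The isomorphism is given on points, as group isomorphisms
`G(R) ≃ R ^ n` natural in the algebra `R` over the algebraic closure. -/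
def IsFormOfGa (n : ℕ) : Prop :=
  ∃ φ : ∀ (R : Type u) [CommRing R] [Algebra F R] [Algebra (AlgebraicClosure F) R]
      [IsScalarTower F (AlgebraicClosure F) R], points p c R ≃+ (Fin n → R),
    ∀ (R S : Type u) [CommRing R] [Algebra F R] [Algebra (AlgebraicClosure F) R]
      [IsScalarTower F (AlgebraicClosure F) R] [CommRing S] [Algebra F S]
      [Algebra (AlgebraicClosure F) S] [IsScalarTower F (AlgebraicClosure F) S]
      (f : R →ₐ[AlgebraicClosure F] S) (x : points p c R) (i : Fin n),
      φ S (pointsMap p c (f.restrictScalars F) x) i = f (φ R x i)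

end PPolynomial

/-! ### Restriction of Galois groups -/

section Restrict

variable {F : Type u} [Field F] {K : Type v} [Field K] [Algebra F K]

/-- The restriction homomorphism `Gal(K_s / K) → Gal(F_s / F)` along an embedding
`ι : F_s → K_s` of separable closures over `F`. -/
def galRestrict (ι : SeparableClosure F →ₐ[F] SeparableClosure K) :
    Gal(SeparableClosure K/K) →* Gal(SeparableClosure F/F) :=
  letI := ι.toRingHom.toAlgebra
  haveI : IsScalarTower F (SeparableClosure F) (SeparableClosure K) :=
    .of_algebraMap_eq' ι.comp_algebraMap.symm
  (AlgEquiv.restrictNormalHom (SeparableClosure F)).comp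
    (AlgEquiv.restrictScalarsHom (S := K) (A := SeparableClosure K) F)

theorem apply_galRestrict (ι : SeparableClosure F →ₐ[F] SeparableClosure K)
    (g : Gal(SeparableClosure K/K)) (x : SeparableClosure F) :
    ι (galRestrict ι g x) = g (ι x) := by
  let := ι.toRingHom.toAlgebra
  have : IsScalarTower F (SeparableClosure F) (SeparableClosure K) :=
    .of_algebraMap_eq' ι.comp_algebraMap.symm
  exact AlgEquiv.restrictNormal_commutes (g.restrictScalars F) (SeparableClosure F) x

theorem continuous_galRestrict (ι : SeparableClosure F →ₐ[F] SeparableClosure K) :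
    Continuous (galRestrict ι) := by
  refine continuous_of_continuousAt_one _ ?_
  rw [ContinuousAt, map_one]
  intro s hs
  obtain ⟨E, hE, hEs⟩ := (krullTopology_mem_nhds_one_iff _ _ s).1 hs
  let b := Module.finBasis F E
  have hU : (⋂ i, (MulAction.stabilizer Gal(SeparableClosure K/K)
      (ι (b i : SeparableClosure F)) : Set Gal(SeparableClosure K/K))) ∈ nhds 1 :=
    (isOpen_iInter_of_finite fun i ↦ stabilizer_isOpen_of_isIntegral _).mem_nhds
      (Set.mem_iInter.2 fun i ↦ one_mem _)
  refine Filter.mem_map.2 <| Filter.mem_of_superset hU fun g hg ↦ hEs ?_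
  have key : (galRestrict ι g : Gal(SeparableClosure F/F)).toLinearMap ∘ₗ E.val.toLinearMap =
      E.val.toLinearMap := by
    refine b.ext fun i ↦ ι.injective ?_
    exact (apply_galRestrict ι g _).trans (Set.mem_iInter.1 hg i)
  refine (IntermediateField.mem_fixingSubgroup_iff _ _).2 fun x hx ↦ ?_
  exact LinearMap.congr_fun key ⟨x, hx⟩

end Restrict

/-! ### Galois cohomology in degree one -/

section Cohomology

variable {F : Type u} [Field F] (p : ℕ) [Fact p.Prime] [CharP F p]
  {m r : ℕ} (c : Fin m → Fin (r + 1) → F)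

/-- The action of `g ∈ Gal(K_s / K)` on `G(K_s)`, for a field extension `K / F`. -/
def galAct {K : Type v} [Field K] [Algebra F K] (g : Gal(SeparableClosure K/K)) :
    points p c (SeparableClosure K) →+ points p c (SeparableClosure K) :=
  pointsMap p c ((g : SeparableClosure K →ₐ[K] SeparableClosure K).restrictScalars F)

variable (K : Type v) [Field K] [Algebra F K]

/-- Continuous `1`-cocycles `Gal(K_s / K) → G(K_s)`, for the Krull topology on the Galois group
and the discrete topology on `G(K_s)`. -/
def cocycles : AddSubgroup (Gal(SeparableClosure K/K) → points p c (SeparableClosure K)) where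
  carrier := {f | IsLocallyConstant f ∧ ∀ g h, f (g * h) = f g + galAct p c g (f h)}
  zero_mem' := ⟨IsLocallyConstant.const 0, fun g h ↦ by simp⟩
  add_mem' := by
    rintro f f' ⟨hf, hf'⟩ ⟨hg, hg'⟩
    refine ⟨hf.add hg, fun g h ↦ ?_⟩
    simp only [Pi.add_apply, hf', hg', map_add]
    abel
  neg_mem' := by
    rintro f ⟨hf, hf'⟩
    refine ⟨hf.neg, fun g h ↦ ?_⟩
    simp only [Pi.neg_apply, hf', map_neg]
    abel

/-- The `1`-coboundaries `g ↦ g a - a` with `a ∈ G(K_s)`, as a subgroup of the cocycles. -/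
def coboundaries : AddSubgroup (cocycles p c K) where
  carrier := {f | ∃ a, ∀ g, f.1 g = galAct p c g a - a}
  zero_mem' := ⟨0, fun g ↦ by simp⟩
  add_mem' := by
    rintro f f' ⟨a, ha⟩ ⟨b, hb⟩
    refine ⟨a + b, fun g ↦ ?_⟩
    change f.1 g + f'.1 g = _
    rw [ha, hb, map_add]
    abel
  neg_mem' := by
    rintro f ⟨a, ha⟩
    refine ⟨-a, fun g ↦ ?_⟩
    change -f.1 g = _
    rw [ha, map_neg]
    abel

/-- The Galois cohomology group `H¹(K, G) = H¹(Gal(K_s / K), G(K_s))`. -/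
abbrev H1 : Type v := cocycles p c K ⧸ coboundaries p c K

variable {K}

/-- The map on cocycles `f ↦ (g ↦ ι (f (g|_{F_s})))` attached to an embedding `ι : F_s → K_s`. -/
def cocyclesRes (ι : SeparableClosure F →ₐ[F] SeparableClosure K) :
    cocycles p c F →+ cocycles p c K where
  toFun f := ⟨fun g ↦ pointsMap p c ι (f.1 (galRestrict ι g)), by
    refine ⟨(f.2.1.comp_continuous (continuous_galRestrict ι)).comp (pointsMap p c ι),
      fun g h ↦ ?_⟩
    change pointsMap p c ι (f.1 (galRestrict ι (g * h))) = pointsMap p c ι (f.1 (galRestrict ι g)) +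
      galAct p c g (pointsMap p c ι (f.1 (galRestrict ι h)))
    rw [map_mul, f.2.2, map_add]
    congr 1
    ext i : 2
    exact apply_galRestrict ι g _⟩
  map_zero' := by ext g i; simp
  map_add' f f' := by ext g i; simp

/-- The map `H¹(F, G) → H¹(K, G)` attached to an embedding `ι : F_s → K_s`. -/
def H1Res (ι : SeparableClosure F →ₐ[F] SeparableClosure K) : H1 p c F →+ H1 p c K :=
  QuotientAddGroup.map _ _ (cocyclesRes p c ι) (by
    rintro f ⟨a, ha⟩
    refine ⟨pointsMap p c ι a, fun g ↦ ?_⟩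
    change pointsMap p c ι (f.1 (galRestrict ι g)) = _
    rw [ha, map_sub]
    congr 1
    ext i : 2
    exact apply_galRestrict ι g _)

variable (K)

/-- The natural map `H¹(F, G) → H¹(K, G)` for a field extension `K / F`, computed with some
embedding of separable closures over `F` (it does not depend on which one). -/
def H1Map : H1 p c F →+ H1 p c K :=
  H1Res p c (IsSepClosed.lift : SeparableClosure F →ₐ[F] SeparableClosure K)

end Cohomology

/-! ### The Tate-Shafarevich group over `𝔽_q(t)` -/

section Sha

variable {k : Type u} [Field k] (p : ℕ) [Fact p.Prime] [CharP k p]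
  {m r : ℕ} (c : Fin m → Fin (r + 1) → RatFunc k)

open Classical in
/-- The Tate-Shafarevich group `Ш(G)` of the group `G` over `F = k(t)`: the classes in `H¹(F, G)`
whose image in `H¹(F_v, G)` is zero for every place `v` of `F`. The places are the maximal ideals
of `k[t]` and the place at infinity. -/
def Sha : AddSubgroup (H1 p c (RatFunc k)) :=
  (⨅ v : IsDedekindDomain.HeightOneSpectrum k[X], (H1Map p c (v.adicCompletion (RatFunc k))).ker) ⊓
    (H1Map p c (RatFunc.CompletionAtInfty k)).ker

end Sha

end WoundSha

end

/-!
A class in `H¹(F, G)` is represented by a single element of `F`. By additive Hilbert 90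
(`exists_eq_apply_sub_of_isLocallyConstant`), a cocycle `f` with values in `G(F_s) ⊆ F_s ^ m` has
the form `f g = g b - b` with `b ∈ F_s ^ m`. As `P` kills every `f g`, the element `a = P(b)` is
Galois invariant, so it lies in `F`. For every extension `K / F`, the class of `f` dies in
`H¹(K, G)` if and only if `a` is a value of `P` on `K ^ m` (`H1Map_mk_eq_zero_iff`). The theorem
therefore says that `a ∈ P(F ^ m)` as soon as `a ∈ P(F_v ^ m)` for all places `v`.

Let `a = P(x_v)` for every finite place `v`. By strong approximation
(`exists_forall_valued_sub_algebraMap_le_one`), there is `y ∈ F ^ m` such that `x_v - y` is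
integral at the poles of `a` and `y` is integral at the other finite places. The coefficients of
`P` are polynomials, so `P` preserves integrality and `a - P(y)` is integral at all finite places,
that is, a polynomial (`exists_sub_pHom_eq_algebraMap`).

It remains to treat a polynomial `f` which equals `P(x)` with `x` over `k((1/t))`. Write
`x = g + z`, where `g` has entries in `k[t]` and `z` has entries in `(1/t) k[[1/t]]`. The bound
`deg c_{i,j} < p ^ j` makes every term `c_{i,j} z_i ^ (p ^ j)` of absolute value less than one. So
the polynomial `f - P(g) = P(z)` has absolute value less than one at infinity and is zero
(`exists_pHom_eq_algebraMap_of_completionAtInfty`).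
-/

namespace WoundSha

open IsDedekindDomain WithZero

/-! ### Additive Hilbert 90 -/

/-- Additive Hilbert 90: `H¹(Gal(L/K), L) = 0` for continuous cocycles of a possibly infinite Galois
extension. -/
theorem exists_eq_apply_sub_of_isLocallyConstant {K : Type u} {L : Type v} [Field K] [Field L]
    [Algebra K L] [IsGalois K L] (f : Gal(L/K) → L) (hf : IsLocallyConstant f)
    (hcoc : ∀ g h, f (g * h) = f g + g (f h)) : ∃ b : L, ∀ g, f g = g b - b := by
  have h1 : f 1 = 0 := by simpa using hcoc 1 1
  obtain ⟨E, _, _, hE⟩ := (krullTopology_mem_nhds_one_iff_of_normal K L _).1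
    ((hf.isOpen_fiber 0).mem_nhds h1)
  have : IsGalois K E := ⟨⟩
  -- `f` vanishes on `Gal(L/E)`, so the cocycle condition makes it constant on its left cosets.
  have key (g h : Gal(L/K)) (hgh : AlgEquiv.restrictNormalHom E g =
      AlgEquiv.restrictNormalHom E h) : f g = f h := by
    have hmem : h⁻¹ * g ∈ E.fixingSubgroup := by
      rw [← IntermediateField.restrictNormalHom_ker, MonoidHom.mem_ker, map_mul, map_inv, hgh,
        inv_mul_cancel]
    have h0 : f (h⁻¹ * g) = 0 := hE hmem
    simpa [h0] using hcoc h (h⁻¹ * g)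
  obtain ⟨θ, hθ⟩ := Algebra.trace_surjective K E 1
  have hθ' : ∑ σ : Gal(E/K), ((σ θ : E) : L) = 1 := by
    have := trace_eq_sum_automorphisms (K := K) θ
    rw [hθ, map_one] at this
    simpa using (congrArg (algebraMap E L) this).symm
  let s := Function.surjInv
    (AlgEquiv.restrictNormalHom_surjective (F := K) (K₁ := E) (E := L))
  have hs (σ) : AlgEquiv.restrictNormalHom E (s σ) = σ :=
    Function.surjInv_eq _ σ
  -- `f` twisted by an element of trace one: the choice of the lifts `s σ` does not matter, and
  -- `g` permutes the terms up to `f g * Tr θ = f g`.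
  refine ⟨-∑ σ : Gal(E/K), f (s σ) * (σ θ : E), fun g ↦ ?_⟩
  have hg : g (∑ σ : Gal(E/K), f (s σ) * (σ θ : E)) =
      ∑ σ : Gal(E/K), f (s σ) * (σ θ : E) - f g := by
    set γ := AlgEquiv.restrictNormalHom E g
    have hgx (x : E) : g x = (γ x : E) :=
      (AlgEquiv.restrictNormal_commutes g E x).symm
    calc _ = ∑ σ, (f (s (γ * σ)) - f g) * ((γ * σ) θ : E) := by
          rw [map_sum]
          refine Finset.sum_congr rfl fun σ _ ↦ ?_
          rw [map_mul, hgx, key (s (γ * σ)) (g * s σ) (by rw [map_mul, hs, hs]), hcoc,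
            add_sub_cancel_left]
          rfl
      _ = ∑ σ, (f (s σ) - f g) * (σ θ : E) :=
          (Group.mulLeft_bijective γ).sum_comp fun σ ↦ (f (s σ) - f g) * (σ θ : E)
      _ = _ := by
          simp only [sub_mul, Finset.sum_sub_distrib, ← Finset.mul_sum, hθ', mul_one]
  rw [map_neg, hg]
  ring

/-! ### Cocycles and values of the `p`-polynomial -/

section Cohomology

variable {F : Type u} [Field F] (p : ℕ) [Fact p.Prime] [CharP F p]
  {m r : ℕ} (c : Fin m → Fin (r + 1) → F)

theorem pHom_apply {R : Type v} [CommRing R] [Algebra F R] (x : Fin m → R) :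
    pHom p c R x = ∑ i, ∑ j, algebraMap F R (c i j) * x i ^ p ^ (j : ℕ) :=
  aeval_pPolynomial p c x

/-- `P` is defined over `F`, hence commutes with homomorphisms of `F`-algebras. -/
theorem map_pHom {R : Type v} {S : Type w} [CommRing R] [Algebra F R] [CommRing S] [Algebra F S]
    (f : R →ₐ[F] S) (x : Fin m → R) : f (pHom p c R x) = pHom p c S (f ∘ x) := by
  simp [pHom_apply]

variable {p c} in
/-- A cocycle with values in `G(K_s)` becomes the coboundary of a point `b` of the ambient affine
space. -/
theorem exists_eq_apply_sub_of_mem_cocycles {K : Type v} [Field K] [Algebra F K]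
    (f : cocycles p c K) :
    ∃ b : Fin m → SeparableClosure K, ∀ g i, (f.1 g).1 i = g (b i) - b i := by
  have h (i : Fin m) : ∃ b : SeparableClosure K, ∀ g, (f.1 g).1 i = g b - b :=
    exists_eq_apply_sub_of_isLocallyConstant _ (f.2.1.comp fun y ↦ y.1 i) fun g h ↦ by
      rw [f.2.2]; rfl
  choose b hb using h
  exact ⟨b, fun g i ↦ hb i g⟩

variable {p c} in
/-- If a cocycle is the coboundary of the point `b` of the ambient space, then it is trivial in
`H¹(K, G)` exactly when `P(b)` is a value of `P` on `K`-points: one may change `b` by `K`-points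
of the ambient space and by points of `G(K_s)`. -/
theorem mem_coboundaries_iff {K : Type v} [Field K] [Algebra F K] {f : cocycles p c K}
    {b : Fin m → SeparableClosure K} (hb : ∀ g i, (f.1 g).1 i = g (b i) - b i) :
    f ∈ coboundaries p c K ↔ ∃ x : Fin m → K,
      pHom p c (SeparableClosure K) b = algebraMap K (SeparableClosure K) (pHom p c K x) := by
  have hmap (x : Fin m → K) : algebraMap K (SeparableClosure K) (pHom p c K x) =
      pHom p c (SeparableClosure K) (algebraMap K (SeparableClosure K) ∘ x) :=
    map_pHom p c (IsScalarTower.toAlgHom F K (SeparableClosure K)) x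
  constructor
  · rintro ⟨y, hy⟩
    have hfix (i : Fin m) : ∃ x : K, algebraMap K (SeparableClosure K) x = b i - y.1 i := by
      refine (InfiniteGalois.mem_range_algebraMap_iff_fixed _).2 fun g ↦ ?_
      have h := hb g i
      rw [hy] at h
      change g (y.1 i) - y.1 i = _ at h
      rw [map_sub]
      linear_combination -h
    choose x hx using hfix
    refine ⟨x, ?_⟩
    have hy0 : pHom p c (SeparableClosure K) y.1 = 0 := y.2
    rw [hmap, show algebraMap K (SeparableClosure K) ∘ x = b - y.1 from funext hx, map_sub, hy0,
      sub_zero]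
  · rintro ⟨x, hx⟩
    refine ⟨⟨b - algebraMap K (SeparableClosure K) ∘ x, ?_⟩, fun g ↦ ?_⟩
    · change pHom p c (SeparableClosure K) _ = 0
      rw [map_sub, hx, hmap, sub_self]
    · ext i : 2
      refine (hb g i).trans ?_
      change _ = g (b i - algebraMap K _ (x i)) - (b i - algebraMap K _ (x i))
      rw [map_sub, AlgEquiv.commutes]
      ring

variable {p c} in
/-- The value `P(b)` is Galois invariant, because `g b - b` lies in the kernel `G` of `P`. -/
theorem exists_pHom_eq_algebraMap {f : cocycles p c F}
    {b : Fin m → SeparableClosure F} (hb : ∀ g i, (f.1 g).1 i = g (b i) - b i) :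
    ∃ a : F, pHom p c (SeparableClosure F) b = algebraMap F (SeparableClosure F) a := by
  obtain ⟨a, ha⟩ := (InfiniteGalois.mem_range_algebraMap_iff_fixed (k := F)
    (pHom p c (SeparableClosure F) b)).2 fun g ↦ by
      have h0 : pHom p c (SeparableClosure F) (f.1 g).1 = 0 := (f.1 g).2
      rw [show (f.1 g).1 = g ∘ b - b from funext (hb g), map_sub, sub_eq_zero] at h0
      exact (map_pHom p c (g.toAlgHom : SeparableClosure F →ₐ[F] SeparableClosure F) b).trans h0
  exact ⟨a, ha.symm⟩

variable {p c} in
/-- The class attached to `a = P(b)` dies in `H¹(K, G)` exactly when `a` is a value of `P` over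
`K`. -/
theorem H1Map_mk_eq_zero_iff {f : cocycles p c F} {b : Fin m → SeparableClosure F}
    (hb : ∀ g i, (f.1 g).1 i = g (b i) - b i) {a : F}
    (ha : pHom p c (SeparableClosure F) b = algebraMap F (SeparableClosure F) a)
    (K : Type v) [Field K] [Algebra F K] :
    H1Map p c K (QuotientAddGroup.mk f) = 0 ↔ ∃ x : Fin m → K, pHom p c K x = algebraMap F K a := by
  let ι : SeparableClosure F →ₐ[F] SeparableClosure K := IsSepClosed.lift
  have hb' (g i) : ((cocyclesRes p c ι f).1 g).1 i = g ((ι ∘ b) i) - (ι ∘ b) i := by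
    change ι ((f.1 (galRestrict ι g)).1 i) = g (ι (b i)) - ι (b i)
    rw [hb, map_sub, apply_galRestrict]
  have h : H1Map p c K (QuotientAddGroup.mk f) = QuotientAddGroup.mk (cocyclesRes p c ι f) := rfl
  have ha' : pHom p c (SeparableClosure K) (ι ∘ b) =
      algebraMap K (SeparableClosure K) (algebraMap F K a) := by
    rw [← map_pHom, ha, AlgHom.commutes, IsScalarTower.algebraMap_apply F K (SeparableClosure K)]
  rw [h, QuotientAddGroup.eq_zero_iff, mem_coboundaries_iff hb', ha']
  simp only [(algebraMap K (SeparableClosure K)).injective.eq_iff, eq_comm]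

end Cohomology

/-! ### Approximation in completions -/

section Approximation

theorem exists_valued_sub_lt_one_of_denseRange {K : Type u} {L : Type v} [Field L]
    [Valued L ℤᵐ⁰] {f : K → L} (hf : DenseRange f) (x : L) : ∃ y, Valued.v (x - f y) < 1 := by
  have hopen : IsOpen {z : L | Valued.v z < 1} := by
    simpa only [Valuation.restrict_lt_one_iff] using Valued.isOpen_ball L (Γ₀ := ℤᵐ⁰) 1
  exact hf.exists_mem_open (hopen.preimage (continuous_const.sub continuous_id)) ⟨x, by simp⟩

variable {R : Type u} [CommRing R] [IsDedekindDomain R] {K : Type v} [Field K] [Algebra R K]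
  [IsFractionRing R K]

/-- Partial fractions: the polar part `y` of `x` at `v`, which is integral at every other place. -/
theorem exists_valuation_sub_le_one (v : HeightOneSpectrum R) (x : K) :
    ∃ y : K, v.valuation K (x - y) ≤ 1 ∧
      ∀ w : HeightOneSpectrum R, w ≠ v → w.valuation K y ≤ 1 := by
  obtain ⟨n, d, hd, rfl⟩ := IsFractionRing.div_surjective (A := R) x
  have hd0 : d ≠ 0 := nonZeroDivisors.ne_zero hd
  have hfin : FiniteMultiplicity v.asIdeal (Ideal.span {d}) :=
    FiniteMultiplicity.of_not_isUnit v.irreducible.not_isUnit (by simpa using hd0)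
  obtain ⟨J, hJ, hvJ⟩ := hfin.exists_eq_pow_mul_and_not_dvd
  -- With `(d) = v ^ e * J` and `1 = α + β`, the summand `n * α / d` is integral at `v`, and
  -- `n * β / d` is integral everywhere else.
  set e := multiplicity v.asIdeal (Ideal.span {d})
  have hcop : IsCoprime (v.asIdeal ^ e) J := by
    refine IsCoprime.pow_left (Ideal.isCoprime_iff_sup_eq.2 (v.isMaximal.1.2 _ ?_))
    exact lt_of_le_of_ne le_sup_left fun h ↦ hvJ (Ideal.dvd_iff_le.2 (h ▸ le_sup_right))
  obtain ⟨α, hα, β, hβ, hαβ⟩ := Ideal.isCoprime_iff_exists.1 hcop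
  have aux (w : HeightOneSpectrum R) (γ : R)
      (hγ : ∀ l : ℕ, d ∈ w.asIdeal ^ l → γ ∈ w.asIdeal ^ l) :
      w.valuation K (algebraMap R K (n * γ) / algebraMap R K d) ≤ 1 := by
    rw [map_div₀, w.valuation_of_algebraMap, w.valuation_of_algebraMap, map_mul]
    refine div_le_one_of_le₀ ((mul_le_of_le_one_left' (w.intValuation_le_one n)).trans ?_) zero_le
    rw [w.intValuation_eq_exp_neg_multiplicity hd0, w.intValuation_le_pow_iff_mem]
    refine hγ _ ((w.intValuation_le_pow_iff_mem _ _).1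
      (w.intValuation_eq_exp_neg_multiplicity hd0).le)
  refine ⟨algebraMap R K (n * β) / algebraMap R K d, ?_, fun w hw ↦ aux w β fun l hl ↦ ?_⟩
  · rw [← sub_div, ← map_sub, ← mul_one_sub, ← hαβ, add_sub_cancel_right]
    refine aux v α fun l hl ↦ Ideal.pow_le_pow_right ?_ hα
    exact hfin.le_multiplicity_of_pow_dvd (Ideal.dvd_span_singleton.2 hl)
  · have hwv : IsCoprime w.asIdeal v.asIdeal := by
      refine Ideal.isCoprime_iff_sup_eq.2 (w.isMaximal.coprime_of_ne v.isMaximal fun h ↦ hw ?_)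
      exact HeightOneSpectrum.ext h
    have h1 : w.asIdeal ^ l ∣ v.asIdeal ^ e * J := hJ ▸ Ideal.dvd_span_singleton.2 hl
    exact Ideal.dvd_iff_le.1 ((hwv.pow).dvd_of_dvd_mul_left h1) hβ

theorem exists_valued_sub_algebraMap_le_one (v : HeightOneSpectrum R) (x : v.adicCompletion K) :
    ∃ y : K, Valued.v (x - algebraMap K (v.adicCompletion K) y) ≤ 1 ∧
      ∀ w : HeightOneSpectrum R, w ≠ v → w.valuation K y ≤ 1 := by
  obtain ⟨z, hz⟩ :=
    exists_valued_sub_lt_one_of_denseRange (HeightOneSpectrum.denseRange_algebraMap K v) x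
  obtain ⟨y, hy, hyw⟩ := exists_valuation_sub_le_one v z
  refine ⟨y, ?_, hyw⟩
  rw [show x - algebraMap K (v.adicCompletion K) y = (x - algebraMap K (v.adicCompletion K) z) +
    algebraMap K (v.adicCompletion K) (z - y) by rw [map_sub]; ring]
  exact Valuation.map_add_le _ hz.le
    ((HeightOneSpectrum.valuedAdicCompletion_eq_valuation' v (z - y)).trans_le hy)

/-- Strong approximation for the additive group, away from the places at infinity. -/
theorem exists_forall_valued_sub_algebraMap_le_one (S : Finset (HeightOneSpectrum R))
    (x : ∀ v : HeightOneSpectrum R, v.adicCompletion K) :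
    ∃ y : K, (∀ v ∈ S, Valued.v (x v - algebraMap K (v.adicCompletion K) y) ≤ 1) ∧
      ∀ v ∉ S, v.valuation K y ≤ 1 := by
  classical
  choose y hy hyw using fun v ↦ exists_valued_sub_algebraMap_le_one v (x v)
  refine ⟨∑ v ∈ S, y v, fun v hv ↦ ?_, fun v hv ↦ ?_⟩
  · rw [← Finset.add_sum_erase S y hv, map_add, ← sub_sub]
    refine Valuation.map_sub_le _ (hy v)
      ((HeightOneSpectrum.valuedAdicCompletion_eq_valuation' v _).trans_le ?_)
    exact Valuation.map_sum_le _ fun w hw ↦ hyw w v (Finset.ne_of_mem_erase hw).symm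
  · exact Valuation.map_sum_le _ fun w hw ↦ hyw w v (ne_of_mem_of_not_mem hw hv).symm

/-- The polynomial part of `x = n / d` is the Euclidean quotient of `n` by `d`. -/
theorem exists_inftyValuation_sub_lt_one {k : Type u} [Field k] [DecidableEq (RatFunc k)]
    (x : RatFunc k) :
    ∃ f : k[X], RatFunc.inftyValuation k (x - algebraMap k[X] (RatFunc k) f) < 1 := by
  obtain ⟨n, d, hd, rfl⟩ := IsFractionRing.div_surjective (A := k[X]) x
  have hd0 : d ≠ 0 := nonZeroDivisors.ne_zero hd
  have hd' : algebraMap k[X] (RatFunc k) d ≠ 0 := by simpa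
  refine ⟨n / d, ?_⟩
  have h : algebraMap k[X] (RatFunc k) n / algebraMap k[X] (RatFunc k) d -
      algebraMap k[X] (RatFunc k) (n / d) =
        algebraMap k[X] (RatFunc k) (n % d) / algebraMap k[X] (RatFunc k) d := by
    rw [div_sub' hd', ← map_mul, ← map_sub, EuclideanDomain.mod_eq_sub_mul_div]
  rw [h, map_div₀, RatFunc.inftyValuation_apply, RatFunc.inftyValuation_apply,
    RatFunc.inftyValuation.polynomial _ hd0]
  rcases eq_or_ne (n % d) 0 with h0 | h0
  · simp [h0, RatFunc.InftyValuation.map_zero']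
  · rw [RatFunc.inftyValuation.polynomial _ h0, div_lt_one₀ (by simp), exp_lt_exp, Nat.cast_lt]
    exact Polynomial.natDegree_lt_natDegree h0 (EuclideanDomain.mod_lt n hd0)

theorem completionAtInfty_denseRange_algebraMap {k : Type u} [Field k]
    [DecidableEq (RatFunc k)] :
    DenseRange (algebraMap (RatFunc k) (RatFunc.CompletionAtInfty k)) :=
  letI := (RatFunc.inftyValued k).toUniformSpace
  UniformSpace.Completion.denseRange_coe (α := RatFunc k)

theorem completionAtInfty_valued_algebraMap {k : Type u} [Field k]
    [DecidableEq (RatFunc k)] (x : RatFunc k) :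
    Valued.v (algebraMap (RatFunc k) (RatFunc.CompletionAtInfty k) x) =
      RatFunc.inftyValuation k x :=
  letI := RatFunc.inftyValued k
  Valued.valuedCompletion_apply x

theorem exists_completionAtInfty_valued_sub_lt_one {k : Type u} [Field k]
    [DecidableEq (RatFunc k)] (x : RatFunc.CompletionAtInfty k) : ∃ f : k[X],
      Valued.v (x - algebraMap (RatFunc k) _ (algebraMap k[X] (RatFunc k) f)) < 1 := by
  obtain ⟨z, hz⟩ := exists_valued_sub_lt_one_of_denseRange completionAtInfty_denseRange_algebraMap x
  obtain ⟨f, hf⟩ := exists_inftyValuation_sub_lt_one z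
  refine ⟨f, ?_⟩
  rw [← sub_add_sub_cancel x (algebraMap (RatFunc k) _ z), ← map_sub]
  exact Valuation.map_add_lt _ hz ((completionAtInfty_valued_algebraMap _).trans_lt hf)

end Approximation

/-! ### From local to global values of the `p`-polynomial -/

section LocalGlobal

theorem valuation_pHom_le_one {F : Type u} [Field F] (p : ℕ) [Fact p.Prime] [CharP F p]
    {m r : ℕ} {c : Fin m → Fin (r + 1) → F} {L : Type v} [Field L] [Algebra F L]
    (w : Valuation L ℤᵐ⁰) (hc : ∀ i j, w (algebraMap F L (c i j)) ≤ 1) {x : Fin m → L}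
    (hx : ∀ i, w (x i) ≤ 1) : w (pHom p c L x) ≤ 1 := by
  rw [pHom_apply]
  refine w.map_sum_le fun i _ ↦ w.map_sum_le fun j _ ↦ ?_
  rw [map_mul, map_pow]
  exact mul_le_one' (hc i j) (pow_le_one' (hx i) _)

/-- If `a` is a value of `P` over every completion of `K` at a prime of `R`, and `P` has integral
coefficients, then `a` is integral up to a value of `P` over `K`. -/
theorem exists_sub_pHom_eq_algebraMap {R : Type u} [CommRing R] [IsDedekindDomain R] {K : Type v}
    [Field K] [Algebra R K] [IsFractionRing R K] (p : ℕ) [Fact p.Prime] [CharP K p] {m r : ℕ}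
    {c : Fin m → Fin (r + 1) → K}
    (hc : ∀ (v : HeightOneSpectrum R) (i j), v.valuation K (c i j) ≤ 1) {a : K}
    (ha : ∀ v : HeightOneSpectrum R, ∃ x : Fin m → v.adicCompletion K,
      pHom p c _ x = algebraMap K _ a) :
    ∃ (x : Fin m → K) (f : R), a - pHom p c K x = algebraMap R K f := by
  choose x hx using ha
  have hS := HeightOneSpectrum.Support.finite R a
  choose y hy hy' using fun i ↦
    exists_forall_valued_sub_algebraMap_le_one hS.toFinset fun v ↦ x v i
  suffices h : a - pHom p c K y ∈ (algebraMap R K).range from ⟨y, h.imp fun _ ↦ Eq.symm⟩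
  refine HeightOneSpectrum.mem_integers_of_valuation_le_one _ _ fun v ↦ ?_
  by_cases hv : v ∈ hS.toFinset
  · have hmap : algebraMap K (v.adicCompletion K) (a - pHom p c K y) =
        pHom p c _ (x v - algebraMap K (v.adicCompletion K) ∘ y) := by
      rw [map_sub, map_sub, hx]
      exact congrArg _ (map_pHom p c (Algebra.ofId K (v.adicCompletion K)) y)
    rw [← HeightOneSpectrum.valuedAdicCompletion_eq_valuation']
    refine (congrArg Valued.v hmap).trans_le (valuation_pHom_le_one p _ (fun i j ↦ ?_) fun i ↦ ?_)
    · exact (HeightOneSpectrum.valuedAdicCompletion_eq_valuation' v _).trans_le (hc v i j)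
    · exact hy i v hv
  · refine Valuation.map_sub_le _ (not_lt.1 (by simpa [HeightOneSpectrum.Support] using hv)) ?_
    exact valuation_pHom_le_one p _ (hc v) fun i ↦ hy' i v hv

variable {k : Type u} [Field k]

/-- The degree bound at work: if `z` has absolute value less than one at infinity, then
`|f z ^ e| ≤ exp (deg f - e) < 1`. -/
theorem valuation_mul_pow_lt_one [DecidableEq (RatFunc k)] {L : Type v} [Field L]
    (w : Valuation L ℤᵐ⁰) {z : L} (hz : w z < 1) {f : k[X]} {e : ℕ} (hf : f.degree < e) :
    RatFunc.inftyValuation k (algebraMap k[X] (RatFunc k) f) * w z ^ e < 1 := by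
  rcases eq_or_ne f 0 with rfl | hf0
  · simp
  have hz' : w z ≤ exp (-1) := by
    rwa [← lt_mul_exp_iff_le, ← exp_add]; simp
  rw [RatFunc.inftyValuation_apply, RatFunc.inftyValuation.polynomial _ hf0]
  calc _ ≤ exp (f.natDegree : ℤ) * exp (-1) ^ e := by gcongr
    _ = exp ((f.natDegree : ℤ) - e) := by rw [← exp_nsmul, ← exp_add]; simp [sub_eq_add_neg]
    _ < 1 := by
      rw [← exp_zero, exp_lt_exp, sub_neg, Nat.cast_lt]
      exact (Polynomial.natDegree_lt_iff_degree_lt hf0).2 hf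

/-- Under the degree bound, a polynomial which is a value of `P` over the completion at infinity is
a value of `P` over `k[t]`, namely at the polynomial part of the given point. -/
theorem exists_pHom_eq_algebraMap_of_completionAtInfty [DecidableEq (RatFunc k)]
    (p : ℕ) [Fact p.Prime] [CharP k p] {m r : ℕ} {c : Fin m → Fin (r + 1) → k[X]}
    (hdeg : ∀ i j, (c i j).degree < ((p ^ (j : ℕ) : ℕ) : WithBot ℕ)) {f : k[X]}
    {x : Fin m → RatFunc.CompletionAtInfty k}
    (hx : pHom p (fun i j ↦ algebraMap k[X] (RatFunc k) (c i j)) _ x =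
      algebraMap (RatFunc k) _ (algebraMap k[X] (RatFunc k) f)) :
    ∃ y : Fin m → RatFunc k, pHom p (fun i j ↦ algebraMap k[X] (RatFunc k) (c i j)) _ y =
      algebraMap k[X] (RatFunc k) f := by
  choose g hg using fun i ↦ exists_completionAtInfty_valued_sub_lt_one (x i)
  let h : k[X] := f - ∑ i, ∑ j, c i j * g i ^ p ^ (j : ℕ)
  let y : Fin m → RatFunc k := algebraMap k[X] (RatFunc k) ∘ g
  have hh : algebraMap k[X] (RatFunc k) h = algebraMap k[X] (RatFunc k) f -
      pHom p (fun i j ↦ algebraMap k[X] (RatFunc k) (c i j)) _ y := by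
    simp [h, y, pHom_apply]
  have hlt : RatFunc.inftyValuation k (algebraMap k[X] (RatFunc k) h) < 1 := by
    have hmap : algebraMap (RatFunc k) (RatFunc.CompletionAtInfty k) (algebraMap k[X] _ h) =
        pHom p (fun i j ↦ algebraMap k[X] (RatFunc k) (c i j)) _
          (x - algebraMap (RatFunc k) (RatFunc.CompletionAtInfty k) ∘ y) := by
      rw [hh, map_sub, map_sub, hx]
      exact congrArg _
        (map_pHom p _ (Algebra.ofId (RatFunc k) (RatFunc.CompletionAtInfty k)) y)
    rw [← completionAtInfty_valued_algebraMap, hmap, pHom_apply]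
    refine Valuation.map_sum_lt _ one_ne_zero fun i _ ↦
      Valuation.map_sum_lt _ one_ne_zero fun j _ ↦ ?_
    rw [map_mul, map_pow, completionAtInfty_valued_algebraMap]
    exact valuation_mul_pow_lt_one _ (hg i) (hdeg i j)
  -- A polynomial of absolute value less than one at infinity is zero.
  have h0 : h = 0 := by
    by_contra h0
    rw [RatFunc.inftyValuation_apply, RatFunc.inftyValuation.polynomial _ h0, ← exp_zero,
      exp_lt_exp] at hlt
    exact (Int.natCast_nonneg _).not_gt hlt
  rw [h0, map_zero] at hh
  exact ⟨y, (sub_eq_zero.1 hh.symm).symm⟩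

end LocalGlobal

end WoundSha

theorem mainTheorem11 (p : ℕ) [Fact p.Prime] (k : Type u) [Field k] [Finite k] [CharP k p]
    (n r : ℕ) (c : Fin (n + 1) → Fin (r + 1) → k[X])
    (hsep : ∃ i, c i 0 ≠ 0)
    (hform : WoundSha.IsFormOfGa p (fun i j ↦ algebraMap k[X] (RatFunc k) (c i j)) n)
    (hdeg : ∀ i j, (c i j).degree < ((p ^ (j : ℕ) : ℕ) : WithBot ℕ)) :
    WoundSha.Sha p (fun i j ↦ algebraMap k[X] (RatFunc k) (c i j)) = ⊥ := by
  classical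
  refine (AddSubgroup.eq_bot_iff_forall _).2 fun x hx ↦ ?_
  obtain ⟨f, rfl⟩ := QuotientAddGroup.mk_surjective x
  obtain ⟨b, hb⟩ := WoundSha.exists_eq_apply_sub_of_mem_cocycles f
  obtain ⟨a, ha⟩ := WoundSha.exists_pHom_eq_algebraMap hb
  obtain ⟨hfin, hinf⟩ := AddSubgroup.mem_inf.1 hx
  simp only [AddSubgroup.mem_iInf, AddMonoidHom.mem_ker,
    WoundSha.H1Map_mk_eq_zero_iff hb ha] at hfin hinf
  rw [QuotientAddGroup.eq_zero_iff, WoundSha.mem_coboundaries_iff hb, ha]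
  obtain ⟨y, g, hg⟩ := WoundSha.exists_sub_pHom_eq_algebraMap (R := k[X]) p
    (fun v i j ↦ v.valuation_le_one (c i j)) hfin
  obtain ⟨z, hz⟩ := hinf
  obtain ⟨y', hy'⟩ := WoundSha.exists_pHom_eq_algebraMap_of_completionAtInfty p hdeg (f := g)
    (x := z - algebraMap (RatFunc k) (RatFunc.CompletionAtInfty k) ∘ y) (by
      rw [map_sub, hz, ← hg, map_sub]
      exact congrArg _ (WoundSha.map_pHom p _
        (Algebra.ofId (RatFunc k) (RatFunc.CompletionAtInfty k)) y).symm)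
  exact ⟨y + y', by rw [map_add, hy', ← hg, add_sub_cancel]⟩
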